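/- Let $n\ge 1$ and $d\ge 2$ be integers and let $k=(k_1,\dots,k_{n+1})$ be integers with $1\le k_i\le d-1$ and $\gcd(k_i,d)=1$ for all $i$. Let $B_{n+1}=\langle s_1,\dots,s_n\rangle$ be the braid group on $n+1$ strands and $P_{n+1}=\ker(B_{n+1}\to S_{n+1})$ the pure braid group. It acts on the free group $F_{n+1}$ on $x_1,\dots,x_{n+1}$ by Artin's formulae $s_i(x_i)=x_ix_{i+1}x_i^{-1}$, $s_i(x_{i+1})=x_i$, $s_i(x_j)=x_j$ for $j\ne i,i+1$. Let $K_0(k,d)$ be the kernel of the homomorphism $F_{n+1}\to\mathbb Z/d\mathbb Z$, $x_i\mapsto k_i$; let $r=\gcd(k_1+\dots+k_{n+1},d)$, let $N$ be the smallest normal subgroup of $F_{n+1}$ containing $x_1^d,\dots,x_{n+1}^d$ and $(x_1x_2\cdots x_{n+1})^{d/r}$, and let $Q_0(k,d)=K_0(k,d)/N$. The action of $P_{n+1}$ on $F_{n+1}$ preserves $K_0(k,d)$ and $N$, so that $P_{n+1}$ acts on $X_0=H_1(Q_0(k,d),\mathbb Q)=Q_0(k,d)^{ab}\otimes\mathbb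 Q$. For a divisor $e\ge 2$ of $d$, put $\omega_e=\exp(2\pi i/e)$, $E_e=\mathbb Q(\omega_e)$ and $t_i=\omega_e^{k_i}$ (so $t_i\neq 1$). Let $x\mapsto(D(x),\chi(x))$ be the homomorphism $F_{n+1}\to E_e^{n+1}\rtimes E_e^*$ with $x_i\mapsto (e_i,t_i)$, where $e_1,\dots,e_{n+1}$ is the standard basis. The Gassner representation of $P_{n+1}$ on $E_e^{n+1}$ at $(t_1,\dots,t_{n+1})$ is given by $b(e_i)=D(b(x_i))$. The reduced Gassner representation $g_n(k,e)$ is its $n$-dimensional subrepresentation spanned by $\varepsilon_i=v_i-v_{i+1}$ $(1\le i\le n)$, where $v_i=e_i/(1-t_i)$. Let $\overline{g_n(k,e)}$ be the quotient of $g_n(k,e)$ by its subspace of $P_{n+1}$-invariant vectors. Then there is an isomorphism of $\mathbb Q$-linear representations of $P_{n+1}$ \[ H_1(Q_0(k,d),\mathbb Q)\;\simeq\;\bigoplus_{e\mid d,\ e\ge 2}\overline{g_n(k,e)}, \] where each $\overline{g_n(k,e)}$ is regarded as a representation over $\mathbb Q$. Moreover, for each divisor $e\ge2$ of $d$, the space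 of invariants of $g_n(k,e)$ has dimension $1$ over $E_e$ if $e$ divides $k_1+\dots+k_{n+1}$, and is zero otherwise. -/

import Mathlib

open scoped TensorProduct DirectSum

noncomputable section

/-! ### Braid groups and the action of the braid group on the free group -/

/-- The relations of the braid group on `n + 1` strands, with generators `s_i`, `i : Fin n`. -/
def braidRels (n : ℕ) : Set (FreeGroup (Fin n)) :=
  {r | ∃ i j : Fin n,
    (i.val + 2 ≤ j.val ∧
      r = (.of i * .of j) * (.of j * .of i)⁻¹) ∨
    (i.val + 1 = j.val ∧
      r = (.of i * .of j * .of i) * (.of j * .of i * .of j)⁻¹)}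

/-- The braid group `B_{n+1}`. -/
abbrev BraidGroup (n : ℕ) : Type := PresentedGroup (braidRels n)

theorem lift_braidRels {n : ℕ} {G : Type*} [Group G] (f : Fin n → G)
    (hcomm : ∀ i j : Fin n, i.val + 2 ≤ j.val → f i * f j = f j * f i)
    (hbraid : ∀ i j : Fin n, i.val + 1 = j.val → f i * f j * f i = f j * f i * f j) :
    ∀ r ∈ braidRels n, FreeGroup.lift f r = 1 := by
  rintro r ⟨i, j, ⟨h, rfl⟩ | ⟨h, rfl⟩⟩
  · simp only [map_mul, map_inv, FreeGroup.lift_apply_of]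
    rw [hcomm i j h, mul_inv_cancel]
  · simp only [map_mul, map_inv, FreeGroup.lift_apply_of]
    rw [hbraid i j h, mul_inv_cancel]

/-- The homomorphism `B_{n+1} → S_{n+1}`, `s_i ↦ (i, i+1)`. -/
def braidPerm (n : ℕ) : BraidGroup n →* Equiv.Perm (Fin (n + 1)) :=
  PresentedGroup.toGroup (f := fun i : Fin n => Equiv.swap i.castSucc i.succ) <| by
    apply lift_braidRels
    · intro i j h
      have e1 : i.castSucc ≠ j.castSucc := by simp [Fin.ext_iff]; omega
      have e2 : i.castSucc ≠ j.succ := by simp [Fin.ext_iff]; omega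
      have e3 : i.succ ≠ j.castSucc := by simp [Fin.ext_iff]; omega
      have e4 : i.succ ≠ j.succ := by simp [Fin.ext_iff]; omega
      rw [Equiv.mul_swap_eq_swap_mul, Equiv.swap_apply_of_ne_of_ne e1.symm e3.symm,
        Equiv.swap_apply_of_ne_of_ne e2.symm e4.symm]
    · intro i j h
      have e0 : j.castSucc = i.succ := by simp [Fin.ext_iff]; omega
      have e2 : i.castSucc ≠ j.succ := by simp [Fin.ext_iff]; omega
      have e4 : i.succ ≠ j.succ := by simp [Fin.ext_iff]; omega
      have e5 : i.castSucc ≠ i.succ := by simp [Fin.ext_iff]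
      rw [e0, Equiv.swap_mul_swap_mul_swap e5 e2, Equiv.swap_comm i.castSucc i.succ,
        Equiv.swap_comm i.succ j.succ, Equiv.swap_mul_swap_mul_swap e4.symm e2.symm,
        Equiv.swap_comm]

/-- The pure braid group `P_{n+1}`. -/
abbrev PureBraidGroup (n : ℕ) : Subgroup (BraidGroup n) := (braidPerm n).ker

/-- The values on the generators of the automorphism `s_i` of the free group:
`x_i ↦ x_i x_{i+1} x_i⁻¹`, `x_{i+1} ↦ x_i`, `x_j ↦ x_j` for the other `j`. -/
def artinFun {n : ℕ} (i : Fin n) (j : Fin (n + 1)) : FreeGroup (Fin (n + 1)) :=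
  if j = i.castSucc then .of i.castSucc * .of i.succ * (.of i.castSucc)⁻¹
  else if j = i.succ then .of i.castSucc
  else .of j

/-- The values on the generators of the inverse of `s_i`. -/
def artinInvFun {n : ℕ} (i : Fin n) (j : Fin (n + 1)) : FreeGroup (Fin (n + 1)) :=
  if j = i.castSucc then .of i.succ
  else if j = i.succ then (.of i.succ)⁻¹ * .of i.castSucc * .of i.succ
  else .of j

theorem succ_ne_castSucc' {n : ℕ} (i : Fin n) : i.succ ≠ i.castSucc := by
  simp [Fin.ext_iff]

/-- The automorphism of the free group given by the generator `s_i`. -/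
def artinGen {n : ℕ} (i : Fin n) : MulAut (FreeGroup (Fin (n + 1))) :=
  MonoidHom.toMulEquiv (FreeGroup.lift (artinFun i)) (FreeGroup.lift (artinInvFun i))
    (by
      ext j
      have := succ_ne_castSucc' i
      by_cases h1 : j = i.castSucc
      · subst h1; simp [artinFun, artinInvFun, this, mul_assoc]
      · by_cases h2 : j = i.succ
        · subst h2; simp [artinFun, artinInvFun, this]
        · simp [artinFun, artinInvFun, h1, h2])
    (by
      ext j
      have := succ_ne_castSucc' i
      by_cases h1 : j = i.castSucc
      · subst h1; simp [artinFun, artinInvFun, this]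
      · by_cases h2 : j = i.succ
        · subst h2; simp [artinFun, artinInvFun, this, mul_assoc]
        · simp [artinFun, artinInvFun, h1, h2])

theorem artinGen_of {n : ℕ} (i : Fin n) (j : Fin (n + 1)) :
    artinGen i (.of j) = artinFun i j := by
  simp [artinGen]

theorem mulAut_free_ext {α : Type*} {f g : MulAut (FreeGroup α)}
    (h : ∀ a, f (.of a) = g (.of a)) : f = g := by
  apply MulEquiv.toMonoidHom_injective
  ext a
  exact h a

/-- Artin's action of the braid group `B_{n+1}` on the free group `F_{n+1}`. -/
def artin (n : ℕ) : BraidGroup n →* MulAut (FreeGroup (Fin (n + 1))) :=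
  PresentedGroup.toGroup (f := fun i : Fin n => artinGen i) <| by
    apply lift_braidRels
    · intro i j h
      apply mulAut_free_ext
      intro a
      have e1 : i.castSucc ≠ j.castSucc := by simp [Fin.ext_iff]; omega
      have e2 : i.castSucc ≠ j.succ := by simp [Fin.ext_iff]; omega
      have e3 : i.succ ≠ j.castSucc := by simp [Fin.ext_iff]; omega
      have e4 : i.succ ≠ j.succ := by simp [Fin.ext_iff]; omega
      have e5 := succ_ne_castSucc' i
      have e6 := succ_ne_castSucc' j
      simp only [MulAut.mul_apply, artinGen_of, artinFun]
      split_ifs <;> simp_all [artinGen_of, artinFun, e1.symm, e2.symm, e3.symm, e4.symm]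
    · intro i j h
      apply mulAut_free_ext
      intro a
      have e0 : j.castSucc = i.succ := by simp [Fin.ext_iff]; omega
      have e2 : i.castSucc ≠ j.succ := by simp [Fin.ext_iff]; omega
      have e4 : i.succ ≠ j.succ := by simp [Fin.ext_iff]; omega
      have e5 := succ_ne_castSucc' i
      simp only [MulAut.mul_apply, artinGen_of, artinFun, e0]
      by_cases h1 : a = i.castSucc
      · subst h1
        simp [artinGen_of, artinFun, e0, e2, e2.symm, e4.symm, e5, e5.symm, mul_assoc]
      · by_cases h2 : a = i.succ
        · subst h2
          simp [artinGen_of, artinFun, e0, e2, e2.symm, e4.symm, e5, e5.symm, mul_assoc]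
        · by_cases h3 : a = j.succ
          · subst h3
            simp [artinGen_of, artinFun, e0, e2, e2.symm, e4.symm, e5, e5.symm]
          · simp [artinGen_of, artinFun, e0, h1, h2, h3]

theorem artin_of {n : ℕ} (i : Fin n) : artin n (PresentedGroup.of i) = artinGen i := by
  simp [artin]

theorem braidPerm_of {n : ℕ} (i : Fin n) :
    braidPerm n (PresentedGroup.of i) = Equiv.swap i.castSucc i.succ := by
  simp [braidPerm]

/-- Induction on braids. -/
theorem braid_induction {n : ℕ} {p : BraidGroup n → Prop} (h1 : p 1)
    (hg : ∀ i, p (PresentedGroup.of i)) (hm : ∀ a b, p a → p b → p (a * b))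
    (hi : ∀ a, p a → p a⁻¹) (b : BraidGroup n) : p b := by
  have hb : b ∈ Subgroup.closure (Set.range (PresentedGroup.of (rels := braidRels n))) := by
    rw [PresentedGroup.closure_range_of]; trivial
  induction hb using Subgroup.closure_induction with
  | mem x hx => obtain ⟨i, rfl⟩ := hx; exact hg i
  | one => exact h1
  | mul x y _ _ hx hy => exact hm x y hx hy
  | inv x _ hx => exact hi x hx

/-- A braid sends each generator to a conjugate of a generator. -/
theorem artin_isConj {n : ℕ} (b : BraidGroup n) :
    ∀ j, IsConj (FreeGroup.of (braidPerm n b j)) (artin n b (.of j)) := by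
  refine braid_induction (p := fun b => ∀ j,
    IsConj (FreeGroup.of (braidPerm n b j)) (artin n b (.of j))) ?_ ?_ ?_ ?_ b
  · intro j
    rw [map_one, map_one]
    exact IsConj.refl _
  · intro i j
    rw [artin_of, braidPerm_of, artinGen_of, artinFun]
    by_cases h1 : j = i.castSucc
    · subst h1
      simp only [Equiv.swap_apply_left, if_true]
      exact isConj_iff.2 ⟨_, rfl⟩
    · by_cases h2 : j = i.succ
      · subst h2
        rw [Equiv.swap_apply_right, if_neg (succ_ne_castSucc' i), if_pos rfl]
      · rw [Equiv.swap_apply_of_ne_of_ne h1 h2, if_neg h1, if_neg h2]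
  · intro a b ha hb j
    simp only [map_mul, Equiv.Perm.mul_apply, MulAut.mul_apply]
    exact (ha _).trans ((artin n a).toMonoidHom.map_isConj (hb j))
  · intro a ha j
    have := (artin n a⁻¹).toMonoidHom.map_isConj (ha (braidPerm n a⁻¹ j))
    simp only [map_inv] at this ⊢
    simpa using this.symm

/-- The product `x_1 x_2 ⋯ x_{n+1}` in the free group. -/
def loopAtInfinity (n : ℕ) : FreeGroup (Fin (n + 1)) :=
  (List.ofFn fun i : Fin (n + 1) => FreeGroup.of i).prod

theorem list_prod_ofFn_congr {G : Type*} [Group G] : ∀ {n : ℕ} (i : Fin n)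
    (f g : Fin (n + 1) → G), (∀ j, j ≠ i.castSucc → j ≠ i.succ → f j = g j) →
    f i.castSucc * f i.succ = g i.castSucc * g i.succ →
    (List.ofFn f).prod = (List.ofFn g).prod
  | 0, i, _, _, _, _ => i.elim0
  | n + 1, i, f, g, h, hi => by
    induction i using Fin.cases with
    | zero =>
      have h2 : (fun j : Fin n => f j.succ.succ) = fun j => g j.succ.succ := by
        funext j
        exact h _ (by simp [Fin.ext_iff]) (by simp [Fin.ext_iff])
      rw [List.ofFn_succ, List.ofFn_succ (f := g), List.ofFn_succ, List.ofFn_succ (f := fun j => g _)]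
      simp only [List.prod_cons, ← mul_assoc, h2]
      congr 1
    | succ i =>
      rw [List.ofFn_succ, List.ofFn_succ (f := g)]
      simp only [List.prod_cons]
      rw [h 0 (by simp [Fin.ext_iff]) (by simp [Fin.ext_iff])]
      congr 1
      apply list_prod_ofFn_congr i
      · intro j h1 h2
        exact h _ (by simpa [Fin.ext_iff] using h1) (by simpa [Fin.ext_iff] using h2)
      · exact hi

/-- The product `x_1 ⋯ x_{n+1}` is fixed by all braids. -/
theorem artin_loopAtInfinity {n : ℕ} (b : BraidGroup n) :
    artin n b (loopAtInfinity n) = loopAtInfinity n := by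
  refine braid_induction (p := fun b => artin n b (loopAtInfinity n) = loopAtInfinity n)
    ?_ ?_ ?_ ?_ b
  · simp
  · intro i
    rw [artin_of, loopAtInfinity, map_list_prod, List.map_ofFn]
    apply list_prod_ofFn_congr i
    · intro j h1 h2
      simp [artinGen_of, artinFun, h1, h2]
    · simp [artinGen_of, artinFun, succ_ne_castSucc']
  · intro a b ha hb
    rw [map_mul, MulAut.mul_apply, hb, ha]
  · intro a ha
    rw [map_inv, MulAut.inv_apply, MulEquiv.symm_apply_eq, ha]

/-- A pure braid does not change the values of a homomorphism to a commutative group. -/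
theorem lift_artin_pure {n : ℕ} {M : Type*} [CommGroup M] (f : FreeGroup (Fin (n + 1)) →* M)
    (b : PureBraidGroup n) (g : FreeGroup (Fin (n + 1))) : f (artin n b g) = f g := by
  suffices h : f.comp (artin n b).toMonoidHom = f from DFunLike.congr_fun h g
  ext j
  have h := f.map_isConj (artin_isConj b.1 j)
  rw [isConj_iff_eq, MonoidHom.mem_ker.1 b.2] at h
  simpa using h.symm

/-! ### The groups `K_0(k,d)` and `Q_0(k,d)` -/

variable {n : ℕ}

/-- `K_0(k,d)`: the kernel of the homomorphism `F_{n+1} → ℤ/d`, `x_i ↦ k_i`. -/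
def K0 (k : Fin (n + 1) → ℕ) (d : ℕ) : Subgroup (FreeGroup (Fin (n + 1))) :=
  (FreeGroup.lift fun i => Multiplicative.ofAdd (k i : ZMod d)).ker

/-- The elements `x_1^d, …, x_{n+1}^d` and `(x_1 ⋯ x_{n+1})^{d/r}`, `r = gcd(∑ k_i, d)`. -/
def punctureLoops (k : Fin (n + 1) → ℕ) (d : ℕ) : Set (FreeGroup (Fin (n + 1))) :=
  insert (loopAtInfinity n ^ (d / Nat.gcd (∑ i, k i) d)) (Set.range fun i => FreeGroup.of i ^ d)

/-- The smallest normal subgroup of `F_{n+1}` containing the elements above. -/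
def N0 (k : Fin (n + 1) → ℕ) (d : ℕ) : Subgroup (FreeGroup (Fin (n + 1))) :=
  Subgroup.normalClosure (punctureLoops k d)

instance (k : Fin (n + 1) → ℕ) (d : ℕ) : (N0 k d).Normal :=
  Subgroup.normalClosure_normal

/-- `Q_0(k,d) = K_0(k,d) / N`; note that `N ≤ K_0(k,d)`, see `N0_le_K0`. -/
abbrev Q0 (k : Fin (n + 1) → ℕ) (d : ℕ) : Type := K0 k d ⧸ (N0 k d).subgroupOf (K0 k d)

theorem N0_le_K0 (k : Fin (n + 1) → ℕ) (d : ℕ) : N0 k d ≤ K0 k d := by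
  have : (K0 k d).Normal := MonoidHom.normal_ker _
  refine Subgroup.normalClosure_le_normal ?_
  intro g hg
  rw [punctureLoops, Set.mem_insert_iff, Set.mem_range] at hg
  rw [SetLike.mem_coe, K0, MonoidHom.mem_ker]
  rcases hg with rfl | ⟨i, rfl⟩
  · rw [map_pow, loopAtInfinity, map_list_prod, List.map_ofFn, List.prod_ofFn]
    simp only [Function.comp_apply, FreeGroup.lift_apply_of]
    rw [← ofAdd_sum, ← ofAdd_nsmul, ofAdd_eq_one, ← Nat.cast_sum, nsmul_eq_mul, ← Nat.cast_mul,
      ZMod.natCast_eq_zero_iff]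
    obtain ⟨c, hc⟩ := Nat.gcd_dvd_left (∑ i, k i) d
    refine ⟨c, ?_⟩
    nth_rewrite 2 [hc]
    rw [← mul_assoc, Nat.div_mul_cancel (Nat.gcd_dvd_right _ _)]
  · rw [map_pow, FreeGroup.lift_apply_of, ← ofAdd_nsmul]
    simp

theorem artin_mem_K0 (k : Fin (n + 1) → ℕ) (d : ℕ) (b : PureBraidGroup n)
    {g : FreeGroup (Fin (n + 1))} (hg : g ∈ K0 k d) : artin n b g ∈ K0 k d := by
  rw [K0, MonoidHom.mem_ker] at hg ⊢
  rw [lift_artin_pure, hg]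

theorem artin_mem_N0 (k : Fin (n + 1) → ℕ) (d : ℕ) (b : PureBraidGroup n)
    {g : FreeGroup (Fin (n + 1))} (hg : g ∈ N0 k d) : artin n b g ∈ N0 k d := by
  suffices h : N0 k d ≤ (N0 k d).comap (artin n b).toMonoidHom from h hg
  refine Subgroup.normalClosure_le_normal ?_
  rintro g hg
  rw [SetLike.mem_coe, Subgroup.mem_comap]
  rw [punctureLoops, Set.mem_insert_iff, Set.mem_range] at hg
  rcases hg with rfl | ⟨i, rfl⟩
  · rw [map_pow]
    simp only [MulEquiv.toMonoidHom_eq_coe, MonoidHom.coe_coe, artin_loopAtInfinity]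
    exact Subgroup.subset_normalClosure (Set.mem_insert _ _)
  · obtain ⟨c, hc⟩ := isConj_iff.1 (artin_isConj b.1 i)
    rw [MonoidHom.mem_ker.1 b.2, Equiv.Perm.one_apply] at hc
    rw [map_pow]
    simp only [MulEquiv.toMonoidHom_eq_coe, MonoidHom.coe_coe, ← hc, conj_pow]
    have hi : FreeGroup.of i ^ d ∈ N0 k d :=
      Subgroup.subset_normalClosure (Set.mem_insert_of_mem _ ⟨i, rfl⟩)
    exact Subgroup.Normal.conj_mem inferInstance _ hi c

/-- The action of a pure braid on `K_0(k,d)`, the restriction of Artin's action. -/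
def artinK0 (k : Fin (n + 1) → ℕ) (d : ℕ) (b : PureBraidGroup n) : K0 k d →* K0 k d :=
  ((artin n b).toMonoidHom.comp (K0 k d).subtype).codRestrict (K0 k d)
    fun g => artin_mem_K0 k d b g.2

/-- The action of the pure braid group on `Q_0(k,d)`, induced by Artin's action. -/
def artinQ0 (k : Fin (n + 1) → ℕ) (d : ℕ) : PureBraidGroup n →* Monoid.End (Q0 k d) where
  toFun b := QuotientGroup.map _ _ (artinK0 k d b) fun g hg => by
    rw [Subgroup.mem_comap, Subgroup.mem_subgroupOf]
    exact artin_mem_N0 k d b (Subgroup.mem_subgroupOf.1 hg)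
  map_one' := by
    ext g
    obtain ⟨g, rfl⟩ := QuotientGroup.mk_surjective g
    have h : artinK0 k d 1 = MonoidHom.id _ := by
      ext x; simp [artinK0]
    simp only [h, QuotientGroup.map_id]
    rfl
  map_mul' a b := by
    ext g
    obtain ⟨g, rfl⟩ := QuotientGroup.mk_surjective g
    have h : artinK0 k d (a * b) = (artinK0 k d a).comp (artinK0 k d b) := by
      ext x; simp [artinK0]
    simp only [h]
    rfl

/-- The first homology group `H_1(Q, ℚ) = Q^{ab} ⊗ ℚ` of a group. -/
abbrev H1Q (Q : Type*) [Group Q] : Type _ := ℚ ⊗[ℤ] Additive (Abelianization Q)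

/-- Functoriality of `H_1(-, ℚ)`: the endomorphisms of a group act on its homology. -/
def H1QRep (Q : Type*) [Group Q] : Representation ℚ (Monoid.End Q) (H1Q Q) where
  toFun f := LinearMap.baseChange ℚ
    (AddMonoidHom.toIntLinearMap (MonoidHom.toAdditive (Abelianization.map f)))
  map_one' := by
    have h : Abelianization.map (1 : Monoid.End Q) = MonoidHom.id _ := Abelianization.map_id
    ext x
    simp [h]
  map_mul' f g := by
    have h : Abelianization.map (f * g) = (Abelianization.map f).comp (Abelianization.map g) :=
      (Abelianization.map_comp (f := g) f).symm
    ext x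
    simp [h]

/-- The representation `X_0` of the pure braid group `P_{n+1}` on `H_1(Q_0(k,d), ℚ)`. -/
def X0 (k : Fin (n + 1) → ℕ) (d : ℕ) : Representation ℚ (PureBraidGroup n) (H1Q (Q0 k d)) :=
  (H1QRep (Q0 k d)).comp (artinQ0 k d)

/-! ### The Gassner representation and the reduced Gassner representation -/

section Gassner

variable {A : Type*} [CommRing A]

/-- Multiplication of vectors by units. -/
def unitsAct (A : Type*) [CommRing A] (n : ℕ) :
    Aˣ →* MulAut (Multiplicative (Fin (n + 1) → A)) :=
  (MulAutMultiplicative (Fin (n + 1) → A)).symm.toMonoidHom.comp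
    (DistribMulAction.toAddAut Aˣ (Fin (n + 1) → A))

/-- The homomorphism `x_i ↦ (e_i, t_i)` from the free group to `A^{n+1} ⋊ Aˣ`, the
specialisation at `X_i ↦ t_i` of the map `x_i ↦ (e_i, X_i)` to `K^{ab} ⋊ F_{n+1}^{ab}`. -/
def magnus (t : Fin (n + 1) → Aˣ) :
    FreeGroup (Fin (n + 1)) →* Multiplicative (Fin (n + 1) → A) ⋊[unitsAct A n] Aˣ :=
  FreeGroup.lift fun i => ⟨Multiplicative.ofAdd (Pi.single i 1), t i⟩

/-- The vector part of `magnus t g`; its coordinates are the Fox derivatives of `g` at `t`. -/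
def vectorPart (t : Fin (n + 1) → Aˣ) (g : FreeGroup (Fin (n + 1))) : Fin (n + 1) → A :=
  Multiplicative.toAdd (magnus t g).left

theorem magnus_right (t : Fin (n + 1) → Aˣ) (g : FreeGroup (Fin (n + 1))) :
    (magnus t g).right = FreeGroup.lift t g := by
  suffices h : SemidirectProduct.rightHom.comp (magnus t) = FreeGroup.lift t from
    DFunLike.congr_fun h g
  ext i
  simp [magnus]

theorem vectorPart_of (t : Fin (n + 1) → Aˣ) (i : Fin (n + 1)) :
    vectorPart t (.of i) = Pi.single i 1 := by
  simp [vectorPart, magnus]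

theorem vectorPart_one (t : Fin (n + 1) → Aˣ) : vectorPart t 1 = 0 := by
  simp [vectorPart]

theorem vectorPart_mul (t : Fin (n + 1) → Aˣ) (g h : FreeGroup (Fin (n + 1))) :
    vectorPart t (g * h) = vectorPart t g + (FreeGroup.lift t g) • vectorPart t h := by
  rw [vectorPart, map_mul, SemidirectProduct.mul_left, magnus_right]
  rfl

theorem vectorPart_inv (t : Fin (n + 1) → Aˣ) (g : FreeGroup (Fin (n + 1))) :
    vectorPart t g⁻¹ = -((FreeGroup.lift t g)⁻¹ • vectorPart t g) := by
  have h := vectorPart_mul t g⁻¹ g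
  rw [inv_mul_cancel, vectorPart_one, map_inv] at h
  exact eq_neg_of_add_eq_zero_left h.symm

/-- The linear map `e_i ↦` (vector part of `b(x_i)`). -/
def gassnerMap (t : Fin (n + 1) → Aˣ) (b : PureBraidGroup n) :
    (Fin (n + 1) → A) →ₗ[A] (Fin (n + 1) → A) :=
  Fintype.linearCombination A fun i => vectorPart t (artin n b (.of i))

theorem gassnerMap_single (t : Fin (n + 1) → Aˣ) (b : PureBraidGroup n) (i : Fin (n + 1)) :
    gassnerMap t b (Pi.single i 1) = vectorPart t (artin n b (.of i)) := by
  rw [gassnerMap, Fintype.linearCombination_apply_single, one_smul]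

theorem gassnerMap_vectorPart (t : Fin (n + 1) → Aˣ) (b : PureBraidGroup n)
    (g : FreeGroup (Fin (n + 1))) :
    gassnerMap t b (vectorPart t g) = vectorPart t (artin n b g) := by
  induction g using FreeGroup.induction_on with
  | C1 => simp [vectorPart_one]
  | of i => rw [vectorPart_of, gassnerMap_single]
  | inv_of i ih =>
    rw [map_inv, vectorPart_inv, vectorPart_inv, lift_artin_pure, ← ih]
    simp only [Units.smul_def, map_neg, map_smul]
  | mul g h hg hh =>
    rw [map_mul, vectorPart_mul, vectorPart_mul, lift_artin_pure, ← hg, ← hh]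
    simp only [Units.smul_def, map_add, map_smul]

/-- The Gassner representation `G_n` of the pure braid group `P_{n+1}` on `A^{n+1}`, at the
parameters `X_i ↦ t_i`: the action of `b` on `x_i = (e_i, t_i)`, read in `A^{n+1} ⋊ Aˣ`. -/
def gassner (t : Fin (n + 1) → Aˣ) :
    Representation A (PureBraidGroup n) (Fin (n + 1) → A) where
  toFun := gassnerMap t
  map_one' := by
    refine LinearMap.pi_ext' fun i => LinearMap.ext_ring ?_
    simp [gassnerMap_single, vectorPart_of]
  map_mul' a b := by
    refine LinearMap.pi_ext' fun i => LinearMap.ext_ring ?_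
    simp [gassnerMap_single, gassnerMap_vectorPart]

/-- The linear form `e_i ↦ 1 - t_i`. -/
def boundary (t : Fin (n + 1) → Aˣ) : (Fin (n + 1) → A) →ₗ[A] A :=
  Fintype.linearCombination A fun i => 1 - (t i : A)

theorem boundary_vectorPart (t : Fin (n + 1) → Aˣ) (g : FreeGroup (Fin (n + 1))) :
    boundary t (vectorPart t g) = 1 - ((FreeGroup.lift t g : Aˣ) : A) := by
  induction g using FreeGroup.induction_on with
  | C1 => simp [vectorPart_one]
  | of i => simp [vectorPart_of, boundary, Fintype.linearCombination_apply_single]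
  | inv_of i ih =>
    rw [vectorPart_inv, Units.smul_def, map_neg, map_smul, ih, map_inv]
    simp [mul_sub]
  | mul g h hg hh =>
    rw [vectorPart_mul, Units.smul_def, map_add, map_smul, hg, hh, map_mul]
    simp [mul_sub]

theorem boundary_gassner (t : Fin (n + 1) → Aˣ) (b : PureBraidGroup n) (w : Fin (n + 1) → A) :
    boundary t (gassner t b w) = boundary t w := by
  suffices h : (boundary t).comp (gassner t b) = boundary t from DFunLike.congr_fun h w
  refine LinearMap.pi_ext' fun i => LinearMap.ext_ring ?_
  have h := boundary_vectorPart t (artin n b (.of i))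
  rw [lift_artin_pure, ← gassnerMap_single, ← boundary_vectorPart, vectorPart_of] at h
  simpa [gassner] using h

/-- The space `W` of the reduced Gassner representation.  If no `t_i` is `1` then, with
`v_i = e_i / (1 - t_i)`, it is the span of the vectors `ε_i = v_i - v_{i+1}`, `1 ≤ i ≤ n`:
see `reducedSpace_eq_span`. -/
def reducedSpace (t : Fin (n + 1) → Aˣ) : Submodule A (Fin (n + 1) → A) :=
  LinearMap.ker (boundary t)

/-- The reduced Gassner representation at the parameters `X_i ↦ t_i`. -/
def reducedGassner (t : Fin (n + 1) → Aˣ) :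
    Representation A (PureBraidGroup n) (reducedSpace t) :=
  (gassner t).subrepresentation (reducedSpace t) fun b w hw => by
    rw [Submodule.mem_comap, reducedSpace, LinearMap.mem_ker, boundary_gassner]
    exact hw

end Gassner

/-- The vector `v_i = e_i / (1 - t_i)`. -/
def vBasis {E : Type*} [Field E] (t : Fin (n + 1) → Eˣ) (i : Fin (n + 1)) : Fin (n + 1) → E :=
  (1 - (t i : E))⁻¹ • Pi.single i 1

theorem reducedSpace_eq_span {E : Type*} [Field E] (t : Fin (n + 1) → Eˣ) (ht : ∀ i, t i ≠ 1) :
    reducedSpace t =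
      Submodule.span E (Set.range fun i : Fin n => vBasis t i.castSucc - vBasis t i.succ) := by
  have hne : ∀ i, 1 - (t i : E) ≠ 0 := fun i h =>
    ht i (Units.ext (by simpa using (sub_eq_zero.1 h).symm))
  have hv : ∀ i, boundary t (vBasis t i) = 1 := fun i => by
    rw [vBasis, map_smul, boundary, Fintype.linearCombination_apply_single, one_smul,
      smul_eq_mul, inv_mul_cancel₀ (hne i)]
  apply le_antisymm
  · intro w hw
    set S := Submodule.span E
      (Set.range fun i : Fin n => vBasis t i.castSucc - vBasis t i.succ) with hS
    have h0 : ∀ i : Fin (n + 1), vBasis t 0 - vBasis t i ∈ S := by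
      intro i
      induction i using Fin.induction with
      | zero => simp
      | succ i ih =>
        have := S.add_mem ih (Submodule.subset_span ⟨i, rfl⟩)
        simpa using this
    have hw' : w = ∑ i, (w i * (1 - (t i : E))) • vBasis t i := by
      conv_lhs => rw [pi_eq_sum_univ' w]
      refine Finset.sum_congr rfl fun i _ => ?_
      rw [vBasis, smul_smul, mul_assoc, mul_inv_cancel₀ (hne i), mul_one]
    have hz : ∑ i, w i * (1 - (t i : E)) = 0 := by
      have := LinearMap.mem_ker.1 hw
      simpa [boundary, Fintype.linearCombination_apply] using this
    have hw'' : w = -∑ i, (w i * (1 - (t i : E))) • (vBasis t 0 - vBasis t i) := by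
      simp only [smul_sub, Finset.sum_sub_distrib, ← Finset.sum_smul, hz, zero_smul, zero_sub,
        neg_neg]
      exact hw'
    rw [hw'']
    exact S.neg_mem (S.sum_mem fun i _ => S.smul_mem _ (h0 i))
  · rw [Submodule.span_le]
    rintro _ ⟨i, rfl⟩
    rw [SetLike.mem_coe, reducedSpace, LinearMap.mem_ker, map_sub, hv, hv, sub_self]

/-! ### Specialisation at roots of unity -/

/-- The primitive `e`-th root of unity `exp(2πi/e)`. -/
def rootExp (e : ℕ) : ℂ := Complex.exp (2 * Real.pi * Complex.I / e)

/-- The cyclotomic field `E_e = ℚ(exp(2πi/e))`. -/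
def Ecyc (e : ℕ) : Type := IntermediateField.adjoin ℚ {rootExp e}

instance (e : ℕ) : Field (Ecyc e) :=
  inferInstanceAs (Field (IntermediateField.adjoin ℚ {rootExp e}))

instance (e : ℕ) : CharZero (Ecyc e) :=
  inferInstanceAs (CharZero (IntermediateField.adjoin ℚ {rootExp e}))

/-- The root of unity `ω_e = exp(2πi/e)` as a unit of `E_e`. -/
def omega (e : ℕ) : (Ecyc e)ˣ :=
  Units.mk0 (IntermediateField.AdjoinSimple.gen ℚ (rootExp e)) fun h =>
    Complex.exp_ne_zero _ (congrArg Subtype.val h)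

/-- The parameters `t_i = ω_e^{k_i}`. -/
def params (k : Fin (n + 1) → ℕ) (e : ℕ) (i : Fin (n + 1)) : (Ecyc e)ˣ := omega e ^ k i

/-- The space `W_n(k,e)` of the representation `g_n(k,e)`. -/
abbrev Wspace (k : Fin (n + 1) → ℕ) (e : ℕ) : Type := reducedSpace (params k e)

/-- The reduced Gassner representation `g_n(k,e)` at `X_i ↦ ω_e^{k_i}`, over `E_e`. -/
def gRed (k : Fin (n + 1) → ℕ) (e : ℕ) :
    Representation (Ecyc e) (PureBraidGroup n) (Wspace k e) :=
  reducedGassner (params k e)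

/-- The quotient of `g_n(k,e)` by its subspace of invariants, over `E_e`. -/
def gBar (k : Fin (n + 1) → ℕ) (e : ℕ) :
    Representation (Ecyc e) (PureBraidGroup n) (Wspace k e ⧸ (gRed k e).invariants) :=
  (gRed k e).quotient (gRed k e).invariants fun b w hw => by
    rw [Submodule.mem_comap, (Representation.mem_invariants _ _).1 hw b]
    exact hw

/-- A representation over an extension field `E` of `ℚ`, seen as a representation over `ℚ`. -/
def restrictToRat {E G V : Type*} [Field E] [CharZero E] [Monoid G] [AddCommGroup V] [Module E V]
    [Module ℚ V] [IsScalarTower ℚ E V] (ρ : Representation E G V) : Representation ℚ G V where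
  toFun g := (ρ g).restrictScalars ℚ
  map_one' := by ext; simp
  map_mul' a b := by ext; simp

end

/-! ### The product of the cyclotomic fields -/

/-! Put A = ℚ[ℤ/d]. The cellular complex of the cyclic cover of a wedge of circles identifies
H_1(K_0, ℚ) with the kernel of ∂ : A^{n+1} → A, e_i ↦ 1 - x_i, the class of g going to its vector
part. Since A is the product of the E_e for e ∣ d (`cycBasis`), this kernel splits: the component at
e ≥ 2 is W_n(k,e), the component at e = 1 is ℚ^{n+1}.

Passing to Q_0 divides by the A-span of the vector parts of the puncture loops. At e = 1 the x_i^d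
contribute d e_i and kill everything. At e ≥ 2 they contribute nothing, while the power of
x_1⋯x_{n+1} contributes a nonzero multiple of the vector part δ of x_1⋯x_{n+1} if e ∣ ∑ k_i, and
zero otherwise. Braids fix x_1⋯x_{n+1}, so δ is invariant, and the pure braids s_i² show that every
Gassner invariant is a multiple of δ (`eq_smul_of_mem_invariants`). As ∂δ = 1 - ∏ t_i, the vector δ
lies in W_n(k,e) exactly when e ∣ ∑ k_i. Hence dividing by the puncture loops is dividing by the
invariants.

The map `vectorH1` induced by the vector part is equivariant by `gassnerMap_vectorPart`. It is
jointly surjective over e because ker ∂ is spanned by vector parts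
(`mem_span_vectorPart_of_boundary_eq_zero`). It is jointly injective because Schreier rewriting
gives a map back (`foxRetraction`), which sends the vector part of g to the class of g and kills the
A-span of the vector parts of N. -/

theorem isPrimitiveRoot_rootExp {e : ℕ} (he : e ≠ 0) : IsPrimitiveRoot (rootExp e) e :=
  Complex.isPrimitiveRoot_exp e he

theorem isPrimitiveRoot_omega {e : ℕ} (he : e ≠ 0) : IsPrimitiveRoot (omega e) e := by
  have h : IsPrimitiveRoot (IntermediateField.AdjoinSimple.gen ℚ (rootExp e)) e := by
    apply IsPrimitiveRoot.of_map_of_injective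
      (f := (IntermediateField.adjoin ℚ {rootExp e}).val) _ Subtype.val_injective
    exact isPrimitiveRoot_rootExp he
  exact IsPrimitiveRoot.coe_units_iff.1 h

theorem finrank_Ecyc {e : ℕ} (he : e ≠ 0) : Module.finrank ℚ (Ecyc e) = e.totient := by
  have h := isPrimitiveRoot_rootExp he
  have hi : IsIntegral ℚ (rootExp e) := (h.isIntegral (Nat.pos_of_ne_zero he)).tower_top
  have h1 : Module.finrank ℚ (IntermediateField.adjoin ℚ {rootExp e}) = e.totient := by
    rw [IntermediateField.adjoin.finrank hi,
      ← Polynomial.cyclotomic_eq_minpoly_rat h (Nat.pos_of_ne_zero he),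
      Polynomial.natDegree_cyclotomic]
  rw [← h1]
  congr!

instance finiteDimensional_Ecyc (e : ℕ) [NeZero e] : FiniteDimensional ℚ (Ecyc e) :=
  FiniteDimensional.of_finrank_pos <| by
    rw [finrank_Ecyc (NeZero.ne e)]; exact Nat.totient_pos.2 (NeZero.pos e)

theorem cyclotomic_dvd_of_aeval_omega {e : ℕ} (he : e ≠ 0) {p : Polynomial ℚ}
    (hp : Polynomial.aeval (omega e : Ecyc e) p = 0) : Polynomial.cyclotomic e ℚ ∣ p := by
  rw [Polynomial.cyclotomic_eq_minpoly_rat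
    (IsPrimitiveRoot.coe_units_iff.2 (isPrimitiveRoot_omega he)) (Nat.pos_of_ne_zero he)]
  exact minpoly.dvd ℚ _ hp

/-- The product of the cyclotomic fields `E_e`, for `e` dividing `d`. -/
abbrev CycProd (d : ℕ) : Type := ∀ e : d.divisors, Ecyc e

theorem ne_zero_of_divisors {d : ℕ} (e : d.divisors) : e.1 ≠ 0 :=
  (Nat.pos_of_mem_divisors e.2).ne'

/-- The element `(ω_e)_e` of the product of the cyclotomic fields. -/
noncomputable def cycGen (d : ℕ) : (CycProd d)ˣ := MulEquiv.piUnits.symm fun e => omega e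

theorem cycGen_apply {d : ℕ} (e : d.divisors) : (cycGen d : CycProd d) e = omega e := rfl

theorem cycGen_pow_self (d : ℕ) : cycGen d ^ d = 1 := by
  ext e
  have h := ((isPrimitiveRoot_omega (ne_zero_of_divisors e)).pow_eq_one_iff_dvd d).2
    (Nat.dvd_of_mem_divisors e.2)
  simpa [cycGen_apply] using congrArg Units.val h

/-- The character `ofAdd c ↦ (ω_e ^ c)_e` of `ℤ/d`. -/
noncomputable def cycChar (d : ℕ) : Multiplicative (ZMod d) →* (CycProd d)ˣ :=
  AddMonoidHom.toMultiplicativeLeft (ZMod.lift d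
    ⟨(zmultiplesHom (Additive (CycProd d)ˣ) (.ofMul (cycGen d))), by
      simpa using congrArg Additive.ofMul (cycGen_pow_self d)⟩)

theorem cycChar_natCast (d m : ℕ) : cycChar d (.ofAdd (m : ZMod d)) = cycGen d ^ m := by
  have h := ZMod.lift_coe d ⟨(zmultiplesHom (Additive (CycProd d)ˣ) (.ofMul (cycGen d))), by
    simpa using congrArg Additive.ofMul (cycGen_pow_self d)⟩ (m : ℤ)
  rw [Int.cast_natCast] at h
  have h2 := congrArg Additive.toMul h
  simpa [cycChar] using h2

/-- This is the identity ∑_{e ∣ d} φ(e) = d. -/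
theorem finrank_cycProd {d : ℕ} : Module.finrank ℚ (CycProd d) = d := by
  have : ∀ e : d.divisors, NeZero e.1 := fun e => ⟨ne_zero_of_divisors e⟩
  rw [Module.finrank_pi_fintype]
  simp only [finrank_Ecyc (ne_zero_of_divisors _)]
  rw [Finset.sum_coe_sort d.divisors (fun e => e.totient), Nat.sum_totient]

/-- A linear relation is a polynomial of degree less than d vanishing at every ω_e. It is divisible
by the pairwise coprime Φ_e, hence by their product X^d - 1, so it is zero. -/
theorem linearIndependent_cycChar (d : ℕ) [NeZero d] :
    LinearIndependent ℚ fun c : Multiplicative (ZMod d) => (cycChar d c : CycProd d) := by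
  classical
  rw [Fintype.linearIndependent_iff]
  intro f hf c
  let p : Polynomial ℚ := ∑ c : ZMod d, Polynomial.C (f (.ofAdd c)) * Polynomial.X ^ c.val
  have hdeg : p.degree < d := by
    refine (Polynomial.degree_sum_le _ _).trans_lt ?_
    rw [Finset.sup_lt_iff (WithBot.bot_lt_coe _)]
    intro c _
    exact (Polynomial.degree_C_mul_X_pow_le _ _).trans_lt (by exact_mod_cast ZMod.val_lt c)
  have hdvd : ∀ e ∈ d.divisors, Polynomial.cyclotomic e ℚ ∣ p := by
    intro e he
    apply cyclotomic_dvd_of_aeval_omega (Nat.pos_of_mem_divisors he).ne'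
    have h := congrFun hf ⟨e, he⟩
    rw [Finset.sum_apply] at h
    simp only [p, map_sum, map_mul, Polynomial.aeval_C, map_pow, Polynomial.aeval_X]
    refine Eq.trans ?_ h
    refine Fintype.sum_equiv Multiplicative.ofAdd _ _ fun c => ?_
    rw [Pi.smul_apply, Algebra.smul_def]
    congr 1
    conv_rhs => rw [← ZMod.natCast_zmod_val c]
    rw [cycChar_natCast]
    simp [cycGen_apply]
  have hX : Polynomial.X ^ d - 1 ∣ p := by
    rw [← Polynomial.prod_cyclotomic_eq_X_pow_sub_one (NeZero.pos d)]
    apply Finset.prod_dvd_of_coprime _ hdvd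
    intro a _ b _ hab
    exact Polynomial.cyclotomic.isCoprime_rat hab
  have hp : p = 0 := by
    refine Polynomial.eq_zero_of_dvd_of_degree_lt hX ?_
    rw [← Polynomial.C_1, Polynomial.degree_X_pow_sub_C (NeZero.pos d)]
    exact hdeg
  have hc := congrArg (fun q => Polynomial.coeff q (Multiplicative.toAdd c).val) hp
  simp only [p, Polynomial.finsetSum_coeff, Polynomial.coeff_C_mul_X_pow, Polynomial.coeff_zero] at hc
  rw [Finset.sum_eq_single (Multiplicative.toAdd c)] at hc
  · simpa using hc
  · intro b _ hb
    rw [if_neg]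
    exact fun h => hb (ZMod.val_injective d h.symm)
  · simp

/-- The `d`-th roots of unity `(ω_e ^ c)_e`, `c ∈ ℤ/d`, form a basis of the product of the
cyclotomic fields. -/
noncomputable def cycBasis (d : ℕ) [NeZero d] :
    Module.Basis (Multiplicative (ZMod d)) ℚ (CycProd d) :=
  basisOfLinearIndependentOfCardEqFinrank (linearIndependent_cycChar d) <| by
    rw [finrank_cycProd, Fintype.card_multiplicative, ZMod.card]

theorem cycBasis_apply (d : ℕ) [NeZero d] (c : Multiplicative (ZMod d)) :
    cycBasis d c = (cycChar d c : CycProd d) := by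
  simp [cycBasis]

/-! ### Fox calculus, the Schreier retraction and the invariants -/

section FoxCalculus

variable {n : ℕ} {A : Type*} [CommRing A]

/-- Applied to the projections of `CycProd d`, this lets one vector over the product record all the
specialisations at once. -/
theorem vectorPart_map {B : Type*} [CommRing B] (f : A →+* B) (t : Fin (n + 1) → Aˣ)
    (g : FreeGroup (Fin (n + 1))) :
    vectorPart (fun i => Units.map f.toMonoidHom (t i)) g = fun j => f (vectorPart t g j) := by
  have hl : ∀ g, FreeGroup.lift (fun i => Units.map f.toMonoidHom (t i)) g =
      Units.map f.toMonoidHom (FreeGroup.lift t g) := by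
    intro g
    rw [← MonoidHom.comp_apply]
    congr 1
    ext i
    simp
  induction g using FreeGroup.induction_on with
  | C1 => funext j; simp [vectorPart_one]
  | of i => funext j; by_cases h : j = i <;> simp [vectorPart_of, h]
  | inv_of i ih =>
    rw [vectorPart_inv, vectorPart_inv, ih, hl]
    funext j
    simp [Units.smul_def, ← map_inv]
  | mul g h hg hh =>
    rw [vectorPart_mul, vectorPart_mul, hg, hh, hl]
    funext j
    simp [Units.smul_def]

theorem vectorPart_pow (t : Fin (n + 1) → Aˣ) (g : FreeGroup (Fin (n + 1))) (m : ℕ) :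
    vectorPart t (g ^ m) =
      (∑ j ∈ Finset.range m, ((FreeGroup.lift t g : Aˣ) : A) ^ j) • vectorPart t g := by
  induction m with
  | zero => simp [vectorPart_one]
  | succ m ih =>
    rw [pow_succ, vectorPart_mul, ih, Finset.sum_range_succ, add_smul, map_pow, Units.smul_def,
      Units.val_pow_eq_pow_val]

theorem vectorPart_conj (t : Fin (n + 1) → Aˣ) (g h : FreeGroup (Fin (n + 1))) :
    vectorPart t (g * h * g⁻¹) =
      (1 - ((FreeGroup.lift t h : Aˣ) : A)) • vectorPart t g +
        ((FreeGroup.lift t g : Aˣ) : A) • vectorPart t h := by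
  rw [vectorPart_mul, vectorPart_mul, vectorPart_inv, map_mul, smul_neg, smul_smul,
    mul_comm (FreeGroup.lift t g), mul_inv_cancel_right]
  simp only [Units.smul_def]
  module

/-- Membership of the vector parts in a submodule extends from a set to its normal closure. -/
theorem vectorPart_mem_of_mem_normalClosure (t : Fin (n + 1) → Aˣ)
    (S : Submodule A (Fin (n + 1) → A)) {s : Set (FreeGroup (Fin (n + 1)))}
    (h1 : ∀ g ∈ s, FreeGroup.lift t g = 1) (hS : ∀ g ∈ s, vectorPart t g ∈ S)
    {g : FreeGroup (Fin (n + 1))} (hg : g ∈ Subgroup.normalClosure s) : vectorPart t g ∈ S := by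
  -- Triviality of the character is carried along the induction: on such elements the vector part is
  -- additive, and conjugation multiplies it by a scalar.
  have key : FreeGroup.lift t g = 1 ∧ vectorPart t g ∈ S := by
    induction hg using Subgroup.closure_induction with
    | mem x hx =>
      obtain ⟨a, ha, hc⟩ := Group.mem_conjugatesOfSet_iff.1 hx
      obtain ⟨c, rfl⟩ := isConj_iff.1 hc
      refine ⟨by simp [h1 a ha], ?_⟩
      rw [vectorPart_conj, h1 a ha, Units.val_one, sub_self, zero_smul, zero_add]
      exact S.smul_mem _ (hS a ha)
    | one => simp [vectorPart_one]
    | mul x y _ _ hx hy =>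
      refine ⟨by simp [hx.1, hy.1], ?_⟩
      rw [vectorPart_mul, hx.1, one_smul]
      exact S.add_mem hx.2 hy.2
    | inv x _ hx =>
      refine ⟨by simp [hx.1], ?_⟩
      rw [vectorPart_inv, hx.1, inv_one, one_smul]
      exact S.neg_mem hx.2
  exact key.2

theorem lift_loopAtInfinity (t : Fin (n + 1) → Aˣ) :
    FreeGroup.lift t (loopAtInfinity n) = ∏ i, t i := by
  rw [loopAtInfinity, map_list_prod, List.map_ofFn, List.prod_ofFn]
  simp

/-- Only the first letter contributes to coordinate 0. The value 1 shows that the vector is nonzero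
and fixes the scalar in `eq_smul_of_mem_invariants`. -/
theorem vectorPart_loopAtInfinity_zero (t : Fin (n + 1) → Aˣ) :
    vectorPart t (loopAtInfinity n) 0 = 1 := by
  have h : ∀ l : List (Fin n),
      vectorPart t (l.map fun i => FreeGroup.of i.succ).prod 0 = 0 := by
    intro l
    induction l with
    | nil => simp [vectorPart_one]
    | cons a l ih =>
      rw [List.map_cons, List.prod_cons, vectorPart_mul, Pi.add_apply, Pi.smul_apply, ih,
        vectorPart_of, Pi.single_eq_of_ne (Fin.succ_ne_zero a).symm]
      simp
  have h2 := h (List.ofFn id)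
  rw [List.map_ofFn] at h2
  rw [loopAtInfinity, List.ofFn_succ, List.prod_cons, vectorPart_mul, vectorPart_of, Pi.add_apply,
    Pi.smul_apply]
  simp only [Function.comp_def, id] at h2
  rw [h2]
  simp

end FoxCalculus

/-! ### Schreier rewriting: from vectors back to homology -/

section Schreier

variable {n : ℕ} {C : Type*} [CommGroup C] (φ : FreeGroup (Fin (n + 1)) →* C)
  {s : C → FreeGroup (Fin (n + 1))} (hs : ∀ c, φ (s c) = c)

/-- The element `s(c) g s(c φ(g))⁻¹` of the kernel of `φ` attached to a section `s` of `φ`. -/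
noncomputable def schreierElt (c : C) (g : FreeGroup (Fin (n + 1))) : φ.ker :=
  ⟨s c * g * (s (c * φ g))⁻¹, by simp [MonoidHom.mem_ker, hs]⟩

/-- The same cocycle rule as `vectorPart_mul`, with the shift c ↦ c φ(g) in place of multiplication
by the character; this match is what makes `foxRetraction` work. -/
theorem schreierElt_mul (c : C) (g h : FreeGroup (Fin (n + 1))) :
    schreierElt φ hs c (g * h) = schreierElt φ hs c g * schreierElt φ hs (c * φ g) h := by
  ext
  simp [schreierElt, mul_assoc]

theorem schreierElt_one (c : C) : schreierElt φ hs c 1 = 1 := by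
  ext
  simp [schreierElt]

theorem schreierElt_inv (c : C) (g : FreeGroup (Fin (n + 1))) :
    schreierElt φ hs c g⁻¹ = (schreierElt φ hs (c * φ g⁻¹) g)⁻¹ := by
  rw [eq_inv_iff_mul_eq_one, ← schreierElt_mul, inv_mul_cancel, schreierElt_one]

theorem schreierElt_of_mem_ker (c : C) (g : φ.ker) :
    (schreierElt φ hs c g : FreeGroup (Fin (n + 1))) = s c * g * (s c)⁻¹ := by
  simp [schreierElt, MonoidHom.mem_ker.1 g.2]

variable {A : Type*} [CommRing A] {χ : C →* Aˣ}

theorem lift_character (g : FreeGroup (Fin (n + 1))) :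
    FreeGroup.lift (fun i => χ (φ (.of i))) g = χ (φ g) := by
  rw [← MonoidHom.comp_apply]
  congr 1
  ext i
  simp

variable [Algebra ℚ A] {b : Module.Basis C ℚ A}

variable {H : Type*} [AddCommGroup H] [Module ℚ H] (κ : φ.ker →* Multiplicative H)

/-- For a homomorphism `κ` from the kernel of `φ` to a vector space, the linear map with
`c e_i ↦ κ (s(c) x_i s(c φ(x_i))⁻¹)`. -/
noncomputable def foxRetraction (b : Module.Basis C ℚ A) : (Fin (n + 1) → A) →ₗ[ℚ] H :=
  ∑ i, (b.constr ℚ fun c => Multiplicative.toAdd (κ (schreierElt φ hs c (.of i)))) ∘ₗ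
    LinearMap.proj i

theorem foxRetraction_single (hb : ∀ c, b c = χ c) (c : C) (i : Fin (n + 1)) :
    foxRetraction φ hs κ b (Pi.single i (χ c : A)) =
      Multiplicative.toAdd (κ (schreierElt φ hs c (.of i))) := by
  rw [foxRetraction, LinearMap.sum_apply, Finset.sum_eq_single i]
  · simp [← hb, Module.Basis.constr_basis]
  · intro j _ hj
    simp [Pi.single_eq_of_ne hj]
  · simp

/-- Both sides obey the same product rule and agree on generators. The induction needs all c at
once, since the rule replaces c by c φ(g). -/
theorem foxRetraction_smul_vectorPart (hb : ∀ c, b c = χ c) (g : FreeGroup (Fin (n + 1))) :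
    ∀ c : C,
    foxRetraction φ hs κ b ((χ c : A) • vectorPart (fun i => χ (φ (.of i))) g) =
      Multiplicative.toAdd (κ (schreierElt φ hs c g)) := by
  induction g using FreeGroup.induction_on with
  | C1 => intro c; simp [vectorPart_one, schreierElt_one]
  | of i =>
    intro c
    rw [vectorPart_of, ← foxRetraction_single φ hs κ hb, ← Pi.single_smul, smul_eq_mul, mul_one]
  | inv_of i ih =>
    intro c
    rw [vectorPart_inv, lift_character, smul_neg, map_neg, Units.smul_def, smul_smul,
      ← Units.val_mul, ← map_inv, ← map_mul, ← map_inv, ih, schreierElt_inv, map_inv κ, toAdd_inv]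
  | mul g h hg hh =>
    intro c
    rw [vectorPart_mul, lift_character, smul_add, map_add, hg, Units.smul_def, smul_smul,
      ← Units.val_mul, ← map_mul, hh, schreierElt_mul, map_mul, toAdd_mul]

theorem foxRetraction_vectorPart (hb : ∀ c, b c = χ c) (g : φ.ker) :
    foxRetraction φ hs κ b (vectorPart (fun i => χ (φ (.of i))) g) =
      Multiplicative.toAdd (κ g) := by
  have h := foxRetraction_smul_vectorPart φ hs κ hb g 1
  rw [map_one, Units.val_one, one_smul] at h
  rw [h]
  -- The section need not send 1 to 1, but the resulting conjugation takes place inside the kernel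
  -- and disappears in the commutative target.
  have h1 : s 1 ∈ φ.ker := by rw [MonoidHom.mem_ker, hs]
  have h2 : schreierElt φ hs 1 g = ⟨s 1, h1⟩ * g * ⟨s 1, h1⟩⁻¹ :=
    Subtype.ext (schreierElt_of_mem_ker φ hs 1 g)
  rw [h2, map_mul κ, map_mul κ, mul_comm (κ _), mul_assoc, ← map_mul κ, mul_inv_cancel, map_one,
    mul_one]

/-- The retraction is only ℚ-linear, but the values χ(c) span A over ℚ, so vanishing for every c
gives vanishing on all A-multiples. -/
theorem foxRetraction_smul_vectorPart_eq_zero (hb : ∀ c, b c = χ c)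
    {g : FreeGroup (Fin (n + 1))}
    (h : ∀ c, κ (schreierElt φ hs c g) = 1) (a : A) :
    foxRetraction φ hs κ b (a • vectorPart (fun i => χ (φ (.of i))) g) = 0 := by
  induction b.mem_span a using Submodule.span_induction with
  | mem x hx =>
    obtain ⟨c, rfl⟩ := hx
    rw [hb, foxRetraction_smul_vectorPart φ hs κ hb, h, toAdd_one]
  | zero => simp
  | add x y _ _ hx hy => rw [add_smul, map_add, hx, hy, add_zero]
  | smul q x _ hx => rw [smul_assoc, map_smul, hx, smul_zero]

/-- The kernel of the boundary map is spanned by the vector parts of the kernel of `φ`. -/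
theorem mem_span_vectorPart_of_boundary_eq_zero (hs : ∀ c, φ (s c) = c)
    (hb : ∀ c, b c = χ c) {v : Fin (n + 1) → A}
    (hv : boundary (fun i => χ (φ (.of i))) v = 0) :
    v ∈ Submodule.span ℚ (Set.range fun g : φ.ker => vectorPart (fun i => χ (φ (.of i))) g.1) := by
  set t : Fin (n + 1) → Aˣ := fun i => χ (φ (.of i)) with ht
  set S := Submodule.span ℚ (Set.range fun g : φ.ker => vectorPart t g.1) with hS
  -- The map f = id + σ∂ is the identity on ker ∂, and the values of σ are chosen so that f sends
  -- the basis vector c e_i to the vector part of a Schreier generator.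
  let σ : A →ₗ[ℚ] (Fin (n + 1) → A) := b.constr ℚ fun c => vectorPart t (s c)
  have hσ : ∀ c, σ (χ c : A) = vectorPart t (s c) := fun c => by
    rw [← hb]; exact b.constr_basis ℚ _ c
  let f : (Fin (n + 1) → A) →ₗ[ℚ] (Fin (n + 1) → A) :=
    LinearMap.id + σ ∘ₗ (boundary t).restrictScalars ℚ
  have hbasis : ∀ i c, f (Pi.single i (χ c : A)) = vectorPart t (schreierElt φ hs c (.of i)).1 := by
    intro i c
    have h1 : boundary t (Pi.single i (χ c : A)) = (χ c : A) - (χ (c * φ (.of i)) : A) := by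
      rw [boundary, Fintype.linearCombination_apply_single, smul_eq_mul, mul_sub, mul_one, map_mul,
        Units.val_mul]
    have h2 : f (Pi.single i (χ c : A)) =
        Pi.single i (χ c : A) + (vectorPart t (s c) - vectorPart t (s (c * φ (.of i)))) := by
      rw [← hσ, ← hσ, ← map_sub, ← h1]
      rfl
    rw [h2, schreierElt, vectorPart_mul, vectorPart_mul, vectorPart_inv, vectorPart_of,
      lift_character, lift_character, lift_character, map_mul, hs, hs, smul_neg, smul_smul,
      mul_inv_cancel, one_smul, Units.smul_def, ← Pi.single_smul, smul_eq_mul, mul_one]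
    abel
  have hmem : ∀ w, f w ∈ S := by
    intro w
    rw [← Finset.univ_sum_single w, map_sum]
    refine S.sum_mem fun i _ => ?_
    generalize w i = a
    induction b.mem_span a using Submodule.span_induction with
    | mem x hx =>
      obtain ⟨c, rfl⟩ := hx
      rw [hb, hbasis]
      exact Submodule.subset_span ⟨_, rfl⟩
    | zero => simp
    | add x y _ _ hx hy => rw [Pi.single_add, map_add]; exact S.add_mem hx hy
    | smul q x _ hx => rw [Pi.single_smul, map_smul]; exact S.smul_mem q hx
  have h := hmem v
  have h3 : f v = v := by
    change v + σ (boundary t v) = v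
    rw [hv, map_zero, add_zero]
  rwa [h3] at h

end Schreier

/-! ### Invariants of the Gassner representation -/

section Invariants

variable {n : ℕ} {E : Type*} [Field E] (t : Fin (n + 1) → Eˣ)

theorem vectorPart_loopAtInfinity_mem_invariants :
    vectorPart t (loopAtInfinity n) ∈ (gassner t).invariants := by
  intro b
  change gassnerMap t b _ = _
  rw [gassnerMap_vectorPart, artin_loopAtInfinity]

/-- The square of the generator `s_i`, a pure braid. -/
def sqBraid (i : Fin n) : PureBraidGroup n :=
  ⟨PresentedGroup.of i * PresentedGroup.of i, by
    rw [MonoidHom.mem_ker, map_mul, braidPerm_of, Equiv.swap_mul_self]⟩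

/-- This single coordinate of s_i² suffices: for an invariant vector the second summand vanishes,
and 1 - t_i can be cancelled. -/
theorem gassner_sqBraid_succ (i : Fin n) (w : Fin (n + 1) → E) :
    gassner t (sqBraid i) w i.succ =
      w i.succ + (1 - (t i.castSucc : E)) * (t i.castSucc * w i.castSucc - w i.succ) := by
  have hne := succ_ne_castSucc' i
  have hc : artin n (sqBraid i).1 (.of i.castSucc) = (FreeGroup.of i.castSucc * .of i.succ) *
      .of i.castSucc * (FreeGroup.of i.castSucc * .of i.succ)⁻¹ := by
    simp [sqBraid, artin_of, artinGen_of, artinFun, hne, mul_assoc]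
  have hsu : artin n (sqBraid i).1 (.of i.succ) =
      .of i.castSucc * .of i.succ * (.of i.castSucc)⁻¹ := by
    simp [sqBraid, artin_of, artinGen_of, artinFun, hne]
  have ho : ∀ j, j ≠ i.castSucc → j ≠ i.succ → artin n (sqBraid i).1 (.of j) = .of j := by
    intro j h1 h2
    simp [sqBraid, artin_of, artinGen_of, artinFun, h1, h2]
  change gassnerMap t (sqBraid i) w i.succ = _
  rw [gassnerMap, Fintype.linearCombination_apply, Finset.sum_apply,
    Fintype.sum_eq_add i.castSucc i.succ hne.symm]
  · rw [hc, hsu, Pi.smul_apply, Pi.smul_apply, vectorPart_conj, vectorPart_conj, vectorPart_mul]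
    simp only [vectorPart_of, Units.smul_def, Pi.add_apply, Pi.smul_apply, Pi.single_eq_same,
      Pi.single_eq_of_ne hne, FreeGroup.lift_apply_of, smul_eq_mul]
    ring
  · rintro j ⟨h1, h2⟩
    rw [ho j h1 h2, vectorPart_of, Pi.smul_apply, Pi.single_eq_of_ne h2.symm, smul_zero]

/-- The invariants of the Gassner representation are the multiples of the vector part of the
loop at infinity. -/
theorem eq_smul_of_mem_invariants (ht : ∀ i, t i ≠ 1) {w : Fin (n + 1) → E}
    (hw : w ∈ (gassner t).invariants) : w = w 0 • vectorPart t (loopAtInfinity n) := by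
  -- This recurrence determines an invariant vector from its coordinate 0; the loop at infinity
  -- satisfies it too, with coordinate 0 equal to 1.
  have key : ∀ u ∈ (gassner t).invariants, ∀ i : Fin n,
      u i.succ = t i.castSucc * u i.castSucc := by
    intro u hu i
    have h := gassner_sqBraid_succ t i u
    rw [hu (sqBraid i), left_eq_add, mul_eq_zero, or_iff_right, sub_eq_zero] at h
    · exact h.symm
    · exact fun h0 => ht i.castSucc (Units.ext (sub_eq_zero.1 h0).symm)
  funext j
  induction j using Fin.induction with
  | zero => simp [vectorPart_loopAtInfinity_zero]
  | succ i ih =>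
    rw [key w hw, ih, Pi.smul_apply, Pi.smul_apply,
      key _ (vectorPart_loopAtInfinity_mem_invariants t), smul_eq_mul, smul_eq_mul]
    ring

theorem mem_invariants_reducedGassner {w : reducedSpace t} :
    w ∈ (reducedGassner t).invariants ↔ w.1 ∈ (gassner t).invariants := by
  simp only [Representation.mem_invariants, Subtype.ext_iff]
  rfl

/-- The invariant line is generated by a vector of boundary 1 - ∏ t_i, so it lies in the reduced
space or meets it in 0 according to whether ∏ t_i = 1. -/
theorem finrank_invariants_reducedGassner (ht : ∀ i, t i ≠ 1) [Decidable (∏ i, t i = 1)] :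
    Module.finrank E (reducedGassner t).invariants = if ∏ i, t i = 1 then 1 else 0 := by
  have hbd : boundary t (vectorPart t (loopAtInfinity n)) = 1 - ((∏ i, t i : Eˣ) : E) := by
    rw [boundary_vectorPart, lift_loopAtInfinity]
  split_ifs with h
  · have hmem : vectorPart t (loopAtInfinity n) ∈ reducedSpace t := by
      rw [reducedSpace, LinearMap.mem_ker, hbd, h, Units.val_one, sub_self]
    refine finrank_eq_one (⟨⟨vectorPart t (loopAtInfinity n), hmem⟩, (mem_invariants_reducedGassner t).2
      (vectorPart_loopAtInfinity_mem_invariants t)⟩ : (reducedGassner t).invariants) ?_ ?_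
    · intro h0
      have h1 := congrFun (congrArg (fun w : (reducedGassner t).invariants => w.1.1) h0) 0
      simp [vectorPart_loopAtInfinity_zero] at h1
    · rintro ⟨w, hw⟩
      exact ⟨w.1 0, Subtype.ext (Subtype.ext (eq_smul_of_mem_invariants t ht
        ((mem_invariants_reducedGassner t).1 hw)).symm)⟩
  · have : (reducedGassner t).invariants = ⊥ := by
      rw [eq_bot_iff]
      intro w hw
      have h1 := eq_smul_of_mem_invariants t ht ((mem_invariants_reducedGassner t).1 hw)
      have h2 : boundary t w.1 = 0 := w.2
      rw [h1, map_smul, hbd, smul_eq_mul, mul_eq_zero, or_iff_left] at h2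
      · rw [h2, zero_smul] at h1
        exact (Submodule.mem_bot _).2 (Subtype.ext h1)
      · exact fun h0 => h (Units.ext (sub_eq_zero.1 h0).symm)
    rw [this, finrank_bot]

end Invariants

/-! ### From the homology of `Q_0(k,d)` to the reduced Gassner representations -/

section

variable {n : ℕ}

/-! ### Parameters at roots of unity -/

section RootsOfUnity

variable (k : Fin (n + 1) → ℕ) (d : ℕ)

/-- The homomorphism `x_i ↦ k_i` from the free group to `ℤ/d`, with kernel `K_0(k,d)`. -/
abbrev degreeHom : FreeGroup (Fin (n + 1)) →* Multiplicative (ZMod d) :=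
  FreeGroup.lift fun i => Multiplicative.ofAdd (k i : ZMod d)

/-- The parameters `(ω_e ^ k_i)_e` in the product of the cyclotomic fields. -/
noncomputable abbrev prodParams (i : Fin (n + 1)) : (CycProd d)ˣ := cycChar d (degreeHom k d (.of i))

/-- Since k_0 is a unit modulo d, powers of the single generator x_0 reach every class. -/
theorem degreeHom_section [NeZero d] (h : Nat.Coprime (k 0) d) (c : Multiplicative (ZMod d)) :
    degreeHom k d (.of 0 ^ (Multiplicative.toAdd c * (k 0 : ZMod d)⁻¹).val) = c := by
  rw [map_pow, FreeGroup.lift_apply_of, ← ofAdd_nsmul, nsmul_eq_mul, ZMod.natCast_zmod_val,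
    mul_assoc, mul_comm _ (k 0 : ZMod d), ZMod.coe_mul_inv_eq_one _ h, mul_one, ofAdd_toAdd]

variable {d}

theorem params_eq_map (e : d.divisors) :
    params k e = fun i => Units.map (Pi.evalRingHom (fun e : d.divisors => Ecyc e) e).toMonoidHom
      (prodParams k d i) := by
  funext i
  ext
  simp [prodParams, cycChar_natCast, params, cycGen_apply]

theorem vectorPart_params (e : d.divisors) (g : FreeGroup (Fin (n + 1))) :
    vectorPart (params k e) g = fun j => vectorPart (prodParams k d) g j e := by
  rw [params_eq_map, vectorPart_map]
  rfl

theorem lift_params {e : ℕ} (he : e ∈ d.divisors) {g : FreeGroup (Fin (n + 1))}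
    (hg : g ∈ K0 k d) : FreeGroup.lift (params k e) g = 1 := by
  have h : FreeGroup.lift (params k e) = (Units.map
      (Pi.evalRingHom (fun e : d.divisors => Ecyc e) ⟨e, he⟩).toMonoidHom).comp
        ((cycChar d).comp (degreeHom k d)) := by
    ext1 i
    rw [params_eq_map k ⟨e, he⟩]
    simp [prodParams]
  rw [h, MonoidHom.comp_apply, MonoidHom.comp_apply, MonoidHom.mem_ker.1 hg, map_one, map_one]

theorem boundary_prodParams_apply (e : d.divisors) (v : Fin (n + 1) → CycProd d) :
    boundary (prodParams k d) v e = boundary (params k e) fun j => v j e := by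
  rw [boundary, boundary, Fintype.linearCombination_apply, Fintype.linearCombination_apply,
    Finset.sum_apply, params_eq_map]
  rfl

variable {k}

theorem params_ne_one {e : ℕ} (hed : e ∣ d) (he : 2 ≤ e) (hkd : ∀ i, Nat.Coprime (k i) d)
    (i : Fin (n + 1)) : params k e i ≠ 1 := by
  rw [params, Ne, (isPrimitiveRoot_omega (by omega)).pow_eq_one_iff_dvd]
  intro h
  have := Nat.dvd_gcd h hed
  rw [hkd i, Nat.dvd_one] at this
  omega

theorem params_pow_eq_one {e : ℕ} (hed : e ∣ d) (he : 2 ≤ e) (i : Fin (n + 1)) :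
    params k e i ^ d = 1 := by
  rw [params, pow_right_comm, ((isPrimitiveRoot_omega (by omega)).pow_eq_one_iff_dvd d).2 hed,
    one_pow]

theorem prod_params_eq_one_iff {e : ℕ} (he : 2 ≤ e) :
    ∏ i, params k e i = 1 ↔ e ∣ ∑ i, k i := by
  simp only [params]
  rw [Finset.prod_pow_eq_pow_sum, (isPrimitiveRoot_omega (by omega)).pow_eq_one_iff_dvd]

/-- The geometric sum of a d-th root of unity other than 1 vanishes. -/
theorem vectorPart_params_of_pow {e : ℕ} (hed : e ∣ d) (he : 2 ≤ e)
    (hkd : ∀ i, Nat.Coprime (k i) d) (i : Fin (n + 1)) :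
    vectorPart (params k e) (.of i ^ d) = 0 := by
  have h1 : (params k e i : Ecyc e) - 1 ≠ 0 := fun h =>
    params_ne_one hed he hkd i (Units.ext (sub_eq_zero.1 h))
  have h2 : (∑ j ∈ Finset.range d, (params k e i : Ecyc e) ^ j) * ((params k e i : Ecyc e) - 1) = 0 := by
    rw [geom_sum_mul, ← Units.val_pow_eq_pow_val, params_pow_eq_one hed he, Units.val_one, sub_self]
  rw [vectorPart_pow, FreeGroup.lift_apply_of, (mul_eq_zero.1 h2).resolve_right h1, zero_smul]

end RootsOfUnity

/-! ### The equivariant map on homology -/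

section Homology

variable (k : Fin (n + 1) → ℕ) (d : ℕ)

/-- The class in `H_1(Q_0(k,d), ℚ)` of an element of `K_0(k,d)`. -/
noncomputable def homologyClass : K0 k d →* Multiplicative (H1Q (Q0 k d)) where
  toFun g := .ofAdd (1 ⊗ₜ Additive.ofMul (Abelianization.of (QuotientGroup.mk g)))
  map_one' := by simp
  map_mul' g h := by simp [TensorProduct.tmul_add]

theorem homologyClass_eq_one {g : K0 k d} (hg : (g : FreeGroup (Fin (n + 1))) ∈ N0 k d) :
    homologyClass k d g = 1 := by
  have h : (QuotientGroup.mk g : Q0 k d) = 1 :=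
    (QuotientGroup.eq_one_iff g).2 (Subgroup.mem_subgroupOf.2 hg)
  simp [homologyClass, h]

theorem X0_homologyClass (b : PureBraidGroup n) (g : K0 k d) :
    X0 k d b (Multiplicative.toAdd (homologyClass k d g)) =
      Multiplicative.toAdd (homologyClass k d (artinK0 k d b g)) := by
  rfl

theorem homologyClass_induction {p : H1Q (Q0 k d) → Prop}
    (hc : ∀ g, p (Multiplicative.toAdd (homologyClass k d g)))
    (hadd : ∀ x y, p x → p y → p (x + y)) (hsmul : ∀ (q : ℚ) x, p x → p (q • x))
    (x : H1Q (Q0 k d)) : p x := by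
  induction x using TensorProduct.induction_on with
  | zero => simpa using hc 1
  | add x y hx hy => exact hadd x y hx hy
  | tmul q a =>
    obtain ⟨a, rfl⟩ := Additive.ofMul.surjective a
    obtain ⟨a, rfl⟩ := QuotientGroup.mk_surjective a
    obtain ⟨g, rfl⟩ := QuotientGroup.mk_surjective a
    have h := hsmul q _ (hc g)
    have h2 : q • Multiplicative.toAdd (homologyClass k d g) =
        q ⊗ₜ[ℤ] Additive.ofMul (Abelianization.of (QuotientGroup.mk g : Q0 k d)) := by
      change q • ((1 : ℚ) ⊗ₜ[ℤ] _) = _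
      rw [TensorProduct.smul_tmul', smul_eq_mul, mul_one]
    rw [h2] at h
    exact h

variable {d}

/-- The vector part of an element of `K_0(k,d)`, in the reduced space. -/
noncomputable def reducedVector {e : ℕ} (he : e ∈ d.divisors) :
    K0 k d →* Multiplicative (Wspace k e) where
  toFun g := .ofAdd ⟨vectorPart (params k e) g, by
    rw [reducedSpace, LinearMap.mem_ker, boundary_vectorPart, lift_params k he g.2, Units.val_one,
      sub_self]⟩
  map_one' := congrArg Multiplicative.ofAdd (Subtype.ext (vectorPart_one _))
  map_mul' g h := by
    rw [← ofAdd_add]; congr 1; ext1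
    simp [vectorPart_mul, lift_params k he g.2]

variable {k}

/-- This is what lets the vector part descend to Q_0: x_i^d contributes zero, and the power of the
loop at infinity contributes a multiple of the invariant vector. -/
theorem vectorPart_mem_invariants_of_mem_N0 {e : ℕ} (hed : e ∣ d) (he : 2 ≤ e) (hd : d ≠ 0)
    (hkd : ∀ i, Nat.Coprime (k i) d) {g : FreeGroup (Fin (n + 1))} (hg : g ∈ N0 k d) :
    vectorPart (params k e) g ∈ (gassner (params k e)).invariants := by
  refine vectorPart_mem_of_mem_normalClosure (params k e) _ (fun g hg => lift_params k
    (Nat.mem_divisors.2 ⟨hed, hd⟩) (N0_le_K0 k d (Subgroup.subset_normalClosure hg))) ?_ hg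
  intro g hg
  rw [punctureLoops, Set.mem_insert_iff, Set.mem_range] at hg
  rcases hg with rfl | ⟨i, rfl⟩
  · rw [vectorPart_pow]
    exact Submodule.smul_mem _ _ (vectorPart_loopAtInfinity_mem_invariants _)
  · rw [vectorPart_params_of_pow hed he hkd]
    exact Submodule.zero_mem _

/-- The homomorphism from `Q_0(k,d)` to the quotient of the reduced Gassner representation
by its invariants, induced by the vector part. -/
noncomputable def vectorQ0 (hd : d ≠ 0) (hkd : ∀ i, Nat.Coprime (k i) d) {e : ℕ} (hed : e ∣ d)
    (he : 2 ≤ e) : Q0 k d →* Multiplicative (Wspace k e ⧸ (gRed k e).invariants) :=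
  QuotientGroup.lift _ ((AddMonoidHom.toMultiplicative
    (gRed k e).invariants.mkQ.toAddMonoidHom).comp
      (reducedVector k (Nat.mem_divisors.2 ⟨hed, hd⟩))) fun g hg => by
    refine congrArg Multiplicative.ofAdd ((Submodule.Quotient.mk_eq_zero _).2 ?_)
    exact (mem_invariants_reducedGassner _).2
      (vectorPart_mem_invariants_of_mem_N0 hed he hd hkd (Subgroup.mem_subgroupOf.1 hg))

/-- The linear map on homology induced by `vectorQ0`. -/
noncomputable def vectorH1 (hd : d ≠ 0) (hkd : ∀ i, Nat.Coprime (k i) d) {e : ℕ} (hed : e ∣ d)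
    (he : 2 ≤ e) : H1Q (Q0 k d) →ₗ[ℚ] Wspace k e ⧸ (gRed k e).invariants :=
  LinearMap.liftBaseChange ℚ (AddMonoidHom.toIntLinearMap
    (MonoidHom.toAdditiveLeft (Abelianization.lift (vectorQ0 hd hkd hed he))))

theorem vectorH1_homologyClass (hd : d ≠ 0) (hkd : ∀ i, Nat.Coprime (k i) d) {e : ℕ} (hed : e ∣ d)
    (he : 2 ≤ e) (g : K0 k d) :
    vectorH1 hd hkd hed he (Multiplicative.toAdd (homologyClass k d g)) =
      Submodule.Quotient.mk
        (Multiplicative.toAdd (reducedVector k (Nat.mem_divisors.2 ⟨hed, hd⟩) g)) := by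
  change vectorH1 hd hkd hed he (1 ⊗ₜ _) = _
  rw [vectorH1, LinearMap.liftBaseChange_tmul, one_smul]
  rfl

theorem vectorH1_X0 (hd : d ≠ 0) (hkd : ∀ i, Nat.Coprime (k i) d) {e : ℕ} (hed : e ∣ d)
    (he : 2 ≤ e) (b : PureBraidGroup n) (x : H1Q (Q0 k d)) :
    vectorH1 hd hkd hed he (X0 k d b x) = gBar k e b (vectorH1 hd hkd hed he x) := by
  induction x using homologyClass_induction with
  | hc g =>
    rw [X0_homologyClass, vectorH1_homologyClass, vectorH1_homologyClass]
    refine congrArg Submodule.Quotient.mk (Subtype.ext ?_)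
    exact (gassnerMap_vectorPart (params k e) b g.1).symm
  | hadd x y hx hy => simp only [map_add, hx, hy]
  | hsmul q x hx =>
    rw [map_smul, map_smul, map_smul, hx]
    exact ((restrictToRat (gBar k e) b).map_smul q _).symm

end Homology

end

/-! ### The isomorphism -/

section

variable {n : ℕ} {k : Fin (n + 1) → ℕ} {d : ℕ}

/-- If all components of `v` at the divisors `e ≥ 2` are invariant then `v` is a combination of
the vector parts of the loops around the punctures. -/
theorem exists_eq_sum_vectorPart (hd : d ≠ 0) (hkd : ∀ i, Nat.Coprime (k i) d)
    {v : Fin (n + 1) → CycProd d} (hv : boundary (prodParams k d) v = 0)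
    (hinv : ∀ e : d.divisors, 2 ≤ e.1 → (fun j => v j e) ∈ (gassner (params k e)).invariants) :
    ∃ (a : CycProd d) (c : Fin (n + 1) → CycProd d),
      v = a • vectorPart (prodParams k d) (loopAtInfinity n ^ (d / Nat.gcd (∑ i, k i) d)) +
        ∑ i, c i • vectorPart (prodParams k d) (.of i ^ d) := by
  classical
  set m := d / Nat.gcd (∑ i, k i) d with hm
  have hm0 : m ≠ 0 := (Nat.div_pos (Nat.gcd_le_right _ (Nat.pos_of_ne_zero hd))
    (Nat.gcd_pos_of_pos_right _ (Nat.pos_of_ne_zero hd))).ne'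
  -- At e ≥ 2 only the loop at infinity is used; when e ∣ ∑ k_i its m-th power has m times its
  -- vector part, whence m⁻¹. At e = 1 the vector part of x_i^d is d e_i, whence d⁻¹.
  refine ⟨fun e => if 2 ≤ e.1 ∧ e.1 ∣ ∑ i, k i then (m : Ecyc e)⁻¹ * v 0 e else 0,
    fun i e => if 2 ≤ e.1 then 0 else (d : Ecyc e)⁻¹ * v i e, ?_⟩
  funext j e
  have hcomp : ∀ g, vectorPart (prodParams k d) g j e = vectorPart (params k e) g j := fun g => by
    rw [vectorPart_params]
  simp only [Pi.add_apply, Pi.smul_apply, Finset.sum_apply, smul_eq_mul, Pi.mul_apply, hcomp]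
  by_cases he : 2 ≤ e.1
  · have hed := Nat.dvd_of_mem_divisors e.2
    have hw := eq_smul_of_mem_invariants (params k e) (params_ne_one hed he hkd) (hinv e he)
    have hwj : v j e = v 0 e * vectorPart (params k e) (loopAtInfinity n) j := congrFun hw j
    simp only [he, if_true, zero_mul, Finset.sum_const_zero, add_zero, true_and]
    split_ifs with hs
    · rw [vectorPart_pow, lift_loopAtInfinity, (prod_params_eq_one_iff he).2 hs]
      have : (m : Ecyc e) ≠ 0 := Nat.cast_ne_zero.2 hm0
      simp only [Units.val_one, one_pow, Finset.sum_const, Finset.card_range, nsmul_eq_mul, mul_one,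
        Pi.smul_apply, smul_eq_mul]
      rw [hwj]
      field_simp
    -- Here the loop at infinity has nonzero boundary, so a multiple of its vector part with zero
    -- boundary is zero, in agreement with the coefficient 0.
    · have hb : boundary (params k e) (fun j => v j e) = 0 := by
        rw [← boundary_prodParams_apply, hv]
        rfl
      rw [hw, map_smul, boundary_vectorPart, lift_loopAtInfinity, smul_eq_mul, mul_eq_zero,
        or_iff_left] at hb
      · rw [hwj, hb, zero_mul, zero_mul]
      · exact fun h0 => hs ((prod_params_eq_one_iff he).1 (Units.ext (sub_eq_zero.1 h0).symm))
  · have he1 : e.1 = 1 := by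
      have := Nat.pos_of_mem_divisors e.2
      omega
    have hone : ∀ i, params k e i = 1 := fun i => by
      have h := (isPrimitiveRoot_omega (ne_zero_of_divisors e)).pow_eq_one
      rw [he1, pow_one] at h
      rw [params, he1, h, one_pow]
    have hd' : (d : Ecyc e) ≠ 0 := Nat.cast_ne_zero.2 hd
    simp only [he, false_and, if_false, zero_mul, zero_add]
    rw [Finset.sum_eq_single j]
    · rw [vectorPart_pow, vectorPart_of, FreeGroup.lift_apply_of, hone]
      simp only [Units.val_one, one_pow, Finset.sum_const, Finset.card_range, nsmul_eq_mul, mul_one,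
        Pi.smul_apply, smul_eq_mul, Pi.single_eq_same]
      field_simp
    · intro i _ hi
      rw [vectorPart_pow, vectorPart_of, Pi.smul_apply, Pi.single_eq_of_ne hi.symm, smul_zero,
        mul_zero]
    · simp

/-- A section of the homomorphism `x_i ↦ k_i` to `ℤ/d`. -/
noncomputable def degreeSection (k : Fin (n + 1) → ℕ) (d : ℕ) (c : Multiplicative (ZMod d)) :
    FreeGroup (Fin (n + 1)) :=
  .of 0 ^ (Multiplicative.toAdd c * (k 0 : ZMod d)⁻¹).val

/-- The map from the vectors over the product of the cyclotomic fields to homology which sends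
the vector part of an element of `K_0(k,d)` to its class. -/
noncomputable def homologyRetraction [NeZero d] (hkd : ∀ i, Nat.Coprime (k i) d) :
    (Fin (n + 1) → CycProd d) →ₗ[ℚ] H1Q (Q0 k d) :=
  foxRetraction (degreeHom k d) (s := degreeSection k d) (degreeHom_section k d (hkd 0))
    (homologyClass k d) (cycBasis d)

theorem homologyRetraction_vectorPart [NeZero d] (hkd : ∀ i, Nat.Coprime (k i) d) (g : K0 k d) :
    homologyRetraction hkd (vectorPart (prodParams k d) g) =
      Multiplicative.toAdd (homologyClass k d g) :=
  foxRetraction_vectorPart (degreeHom k d) (degreeHom_section k d (hkd 0)) (homologyClass k d)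
    (cycBasis_apply d) g

/-- For g in N the Schreier elements are the conjugates s(c) g s(c)⁻¹, which stay in N and have
trivial class. -/
theorem homologyRetraction_smul_vectorPart_eq_zero [NeZero d] (hkd : ∀ i, Nat.Coprime (k i) d)
    {g : FreeGroup (Fin (n + 1))} (hg : g ∈ N0 k d) (a : CycProd d) :
    homologyRetraction hkd (a • vectorPart (prodParams k d) g) = 0 := by
  refine foxRetraction_smul_vectorPart_eq_zero (degreeHom k d) (degreeHom_section k d (hkd 0))
    (homologyClass k d) (cycBasis_apply d) (fun c => ?_) a
  apply homologyClass_eq_one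
  have h := schreierElt_of_mem_ker (degreeHom k d) (s := degreeSection k d)
    (degreeHom_section k d (hkd 0)) c ⟨g, N0_le_K0 k d hg⟩
  exact h ▸ Subgroup.Normal.conj_mem inferInstance g hg _

/-- The vector part on K_0 does not descend to Q_0, so a class has no canonical lift v. Existence is
enough, and the required properties are stable under sums and rational multiples. -/
theorem exists_homologyRetraction_eq [NeZero d] (hkd : ∀ i, Nat.Coprime (k i) d)
    (x : H1Q (Q0 k d)) :
    ∃ v : Fin (n + 1) → CycProd d, homologyRetraction hkd v = x ∧
      boundary (prodParams k d) v = 0 ∧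
      ∀ (e : d.divisors) (he : 2 ≤ e.1), ∃ w : Wspace k e, w.1 = (fun j => v j e) ∧
        vectorH1 (NeZero.ne d) hkd (Nat.dvd_of_mem_divisors e.2) he x =
          Submodule.Quotient.mk w := by
  induction x using homologyClass_induction with
  | hc g =>
    refine ⟨vectorPart (prodParams k d) g, homologyRetraction_vectorPart hkd g, ?_, fun e he =>
      ⟨_, ?_, vectorH1_homologyClass _ _ _ _ g⟩⟩
    · rw [boundary_vectorPart, lift_character, MonoidHom.mem_ker.1 g.2, map_one, Units.val_one,
        sub_self]
    · rw [← vectorPart_params]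
      rfl
  | hadd x y hx hy =>
    obtain ⟨v, h1, h2, h3⟩ := hx
    obtain ⟨v', h1', h2', h3'⟩ := hy
    refine ⟨v + v', by rw [map_add, h1, h1'], by rw [map_add, h2, h2', add_zero], fun e he => ?_⟩
    obtain ⟨w, hw, hw2⟩ := h3 e he
    obtain ⟨w', hw', hw2'⟩ := h3' e he
    refine ⟨w + w', ?_, by rw [map_add, hw2, hw2', Submodule.Quotient.mk_add]⟩
    rw [Submodule.coe_add, hw, hw']
    rfl
  | hsmul q x hx =>
    obtain ⟨v, h1, h2, h3⟩ := hx
    refine ⟨q • v, by rw [map_smul, h1], ?_, fun e he => ?_⟩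
    · have := ((boundary (prodParams k d)).restrictScalars ℚ).map_smul q v
      rw [LinearMap.coe_restrictScalars, h2, smul_zero] at this
      exact this
    · obtain ⟨w, hw, hw2⟩ := h3 e he
      refine ⟨q • w, ?_, ?_⟩
      · rw [Submodule.coe_smul_of_tower, hw]
        rfl
      · rw [map_smul, hw2, Submodule.Quotient.mk_smul]

/-- Joint injectivity: a lift of x has invariant components at all e ≥ 2, hence is a combination of
puncture loops, which the retraction kills. -/
theorem eq_zero_of_vectorH1_eq_zero [NeZero d] (hkd : ∀ i, Nat.Coprime (k i) d)
    (x : H1Q (Q0 k d))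
    (hx : ∀ (e : ℕ) (hed : e ∣ d) (he : 2 ≤ e), vectorH1 (NeZero.ne d) hkd hed he x = 0) :
    x = 0 := by
  obtain ⟨v, rfl, hv, h⟩ := exists_homologyRetraction_eq hkd x
  obtain ⟨a, c, hac⟩ := exists_eq_sum_vectorPart (NeZero.ne d) hkd hv fun e he => by
    obtain ⟨w, hw, hw2⟩ := h e he
    rw [hx, eq_comm, Submodule.Quotient.mk_eq_zero] at hw2
    rw [← hw]
    exact (mem_invariants_reducedGassner _).1 hw2
  rw [hac, map_add, map_sum, homologyRetraction_smul_vectorPart_eq_zero hkd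
    (Subgroup.subset_normalClosure (Set.mem_insert _ _)), zero_add]
  exact Finset.sum_eq_zero fun i _ => homologyRetraction_smul_vectorPart_eq_zero hkd
    (Subgroup.subset_normalClosure (Set.mem_insert_of_mem _ ⟨i, rfl⟩)) _

theorem exists_vectorH1_eq [NeZero d] (hkd : ∀ i, Nat.Coprime (k i) d)
    (y : ∀ e : {e : ℕ // e ∣ d ∧ 2 ≤ e}, Wspace k e.1 ⧸ (gRed k e.1).invariants) :
    ∃ x, ∀ e : {e : ℕ // e ∣ d ∧ 2 ≤ e},
      vectorH1 (NeZero.ne d) hkd e.2.1 e.2.2 x = y e := by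
  classical
  choose w hw using fun e => Submodule.Quotient.mk_surjective _ (y e)
  -- Representatives for the different e are glued into one vector; the component at e = 1, which no
  -- target sees, is set to 0.
  let v : Fin (n + 1) → CycProd d := fun j e =>
    if he : 2 ≤ e.1 then (w ⟨e.1, Nat.dvd_of_mem_divisors e.2, he⟩).1 j else 0
  have hvw : ∀ e : {e : ℕ // e ∣ d ∧ 2 ≤ e},
      (fun j => v j ⟨e.1, Nat.mem_divisors.2 ⟨e.2.1, NeZero.ne d⟩⟩) = (w e).1 := by
    intro e
    funext j
    exact dif_pos e.2.2
  have hbd : boundary (prodParams k d) v = 0 := by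
    funext e
    rw [boundary_prodParams_apply]
    by_cases he : 2 ≤ e.1
    · have h1 : (fun j => v j e) = _ := hvw ⟨e.1, Nat.dvd_of_mem_divisors e.2, he⟩
      rw [h1]
      exact (w ⟨e.1, Nat.dvd_of_mem_divisors e.2, he⟩).2
    · have h1 : (fun j => v j e) = 0 := funext fun j => dif_neg he
      rw [h1, map_zero]
      rfl
  -- Vector parts of elements of K_0 come from their classes simultaneously at all e, and this
  -- passes to their ℚ-span, which contains v.
  have key : ∀ u ∈ Submodule.span ℚ (Set.range fun g : (degreeHom k d).ker =>
      vectorPart (prodParams k d) g.1), ∃ x, ∀ e : {e : ℕ // e ∣ d ∧ 2 ≤ e}, ∃ w : Wspace k e.1,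
      w.1 = (fun j => u j ⟨e.1, Nat.mem_divisors.2 ⟨e.2.1, NeZero.ne d⟩⟩) ∧
        vectorH1 (NeZero.ne d) hkd e.2.1 e.2.2 x = Submodule.Quotient.mk w := by
    intro u hu
    induction hu using Submodule.span_induction with
    | mem u hu =>
      obtain ⟨g, rfl⟩ := hu
      refine ⟨Multiplicative.toAdd (homologyClass k d g), fun e =>
        ⟨_, ?_, vectorH1_homologyClass _ _ _ _ g⟩⟩
      rw [← vectorPart_params]
      rfl
    | zero => exact ⟨0, fun e => ⟨0, rfl, by rw [map_zero, Submodule.Quotient.mk_zero]⟩⟩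
    | add u u' _ _ hu hu' =>
      obtain ⟨x, hx⟩ := hu
      obtain ⟨x', hx'⟩ := hu'
      refine ⟨x + x', fun e => ?_⟩
      obtain ⟨w, hw, hw2⟩ := hx e
      obtain ⟨w', hw', hw2'⟩ := hx' e
      refine ⟨w + w', ?_, by rw [map_add, hw2, hw2', Submodule.Quotient.mk_add]⟩
      rw [Submodule.coe_add, hw, hw']
      rfl
    | smul q u _ hu =>
      obtain ⟨x, hx⟩ := hu
      refine ⟨q • x, fun e => ?_⟩
      obtain ⟨w, hw, hw2⟩ := hx e
      refine ⟨q • w, ?_, by rw [map_smul, hw2, Submodule.Quotient.mk_smul]⟩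
      rw [Submodule.coe_smul_of_tower, hw]
      rfl
  obtain ⟨x, hx⟩ := key v (mem_span_vectorPart_of_boundary_eq_zero (degreeHom k d)
    (s := degreeSection k d) (degreeHom_section k d (hkd 0)) (cycBasis_apply d) hbd)
  refine ⟨x, fun e => ?_⟩
  obtain ⟨w', hw', hx'⟩ := hx e
  rw [hx', ← hw]
  congr 1
  exact Subtype.ext (hw'.trans (hvw e))

end

theorem mainTheorem6 (n d : ℕ) (hn : 1 ≤ n) (hd : 2 ≤ d) (k : Fin (n + 1) → ℕ)
    (hk : ∀ i, 1 ≤ k i ∧ k i ≤ d - 1) (hkd : ∀ i, Nat.Coprime (k i) d) :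
    Nonempty ((X0 k d).Equiv
      (Representation.directSum fun e : {e : ℕ // e ∣ d ∧ 2 ≤ e} =>
        restrictToRat (gBar k e.1))) ∧
    ∀ e : ℕ, e ∣ d → 2 ≤ e →
      Module.finrank (Ecyc e) (gRed k e).invariants = if e ∣ ∑ i, k i then 1 else 0 := by
  classical
  have : NeZero d := ⟨by omega⟩
  constructor
  · have : Finite {e : ℕ // e ∣ d ∧ 2 ≤ e} :=
      Finite.of_injective (β := d.divisors)
        (fun e => ⟨e.1, Nat.mem_divisors.2 ⟨e.2.1, NeZero.ne d⟩⟩) fun a b h => by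
          simpa [Subtype.ext_iff] using h
    have := Fintype.ofFinite {e : ℕ // e ∣ d ∧ 2 ≤ e}
    let Φ : H1Q (Q0 k d) →ₗ[ℚ]
        ∀ e : {e : ℕ // e ∣ d ∧ 2 ≤ e}, Wspace k e.1 ⧸ (gRed k e.1).invariants :=
      LinearMap.pi fun e => vectorH1 (NeZero.ne d) hkd e.2.1 e.2.2
    have hΦ : Function.Bijective Φ := by
      constructor
      · rw [injective_iff_map_eq_zero]
        intro x hx
        exact eq_zero_of_vectorH1_eq_zero hkd x fun e hed he => congrFun hx ⟨e, hed, he⟩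
      · intro y
        obtain ⟨x, hx⟩ := exists_vectorH1_eq hkd y
        exact ⟨x, funext hx⟩
    -- There are finitely many divisors, so the direct sum is the product and equivariance can be
    -- checked one e at a time.
    let ι := DirectSum.linearEquivFunOnFintype ℚ {e : ℕ // e ∣ d ∧ 2 ≤ e}
      fun e => Wspace k e.1 ⧸ (gRed k e.1).invariants
    refine ⟨.mk ((LinearEquiv.ofBijective Φ hΦ).trans ι.symm) fun b => ?_⟩
    apply LinearMap.ext
    intro x
    apply ι.injective
    funext e
    have h1 : ∀ z, ι (ι.symm z) e = z e := fun z => congrFun (ι.apply_symm_apply z) e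
    have h2 : ∀ z, ι (Representation.directSum (fun e : {e : ℕ // e ∣ d ∧ 2 ≤ e} =>
        restrictToRat (gBar k e.1)) b z) e = gBar k e.1 b (ι z e) := fun z => rfl
    simp only [LinearMap.comp_apply, LinearEquiv.coe_coe, LinearEquiv.trans_apply, h1, h2]
    exact vectorH1_X0 (NeZero.ne d) hkd e.2.1 e.2.2 b x
  · intro e hed he
    rw [gRed, finrank_invariants_reducedGassner _ (params_ne_one hed he hkd)]
    simp only [prod_params_eq_one_iff he]
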